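/- For a matrix $A\in\mathbb C^{4\times4}$ let $W(A)=\{\langle Ax,x\rangle : x\in\mathbb C^4,\ \|x\|=1\}$ be its numerical range. A subset of $\mathbb C$ is called bi-elliptical if it is the convex hull of two (non-degenerate) ellipses with distinct centers, neither of which lies in the convex hull of the other; circles count as ellipses. Let $b_1,b_2\in\mathbb C$, $b\in\mathbb R$, and $$A=\begin{bmatrix}0&0&\overline{b_1}+1&0\\0&0&b&\overline{b_2}+1\\b_1-1&b&0&0\\0&b_2-1&0&0\end{bmatrix}.$$ Then $W(A)$ is bi-elliptical if and only if $b\neq0$ and at least one of the following holds: (i) $\operatorname{Im}b_1=\operatorname{Im}b_2$ and $|b_1|=|b_2|$, or (ii) $\operatorname{Re}b_1=\operatorname{Re}b_2=0$. -/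

import Mathlib

/-- The numerical range `W(A) = {⟨Ax, x⟩ : ‖x‖ = 1}` of a square complex matrix, with respect to the
standard (Euclidean) inner product.  Mathlib's inner product is conjugate-linear in its first
argument, so `inner ℂ x (A x) = ∑ i, (A x) i * conj (x i)`. -/
def numericalRange {n : Type*} [Fintype n] [DecidableEq n] (A : Matrix n n ℂ) : Set ℂ :=
  {w | ∃ x : EuclideanSpace ℂ n, ‖x‖ = 1 ∧ w = inner ℂ x (Matrix.toEuclideanLin A x)}

/-- `E` is a non-degenerate ellipse (the curve, circles included) with center `c`: for some
semi-axes `r, s > 0` and some rotation angle `φ`, it is the curve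
`c + e^{iφ} (r cos t + i s sin t)`. -/
def IsEllipseWithCenter (E : Set ℂ) (c : ℂ) : Prop :=
  ∃ r s φ : ℝ, 0 < r ∧ 0 < s ∧
    E = Set.range fun t : ℝ =>
      c + Complex.exp (φ * Complex.I) *
        ((r * Real.cos t : ℝ) + (s * Real.sin t : ℝ) * Complex.I)

/-- A planar set is bi-elliptical if it is the convex hull of two non-degenerate ellipses with
distinct centers.  Neither ellipse may lie in the convex hull of the other one: otherwise the
hull is just one elliptical disk, and every elliptical disk would qualify. -/
def IsBiElliptical (S : Set ℂ) : Prop :=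
  ∃ (E₁ E₂ : Set ℂ) (c₁ c₂ : ℂ),
    IsEllipseWithCenter E₁ c₁ ∧ IsEllipseWithCenter E₂ c₂ ∧ c₁ ≠ c₂ ∧
    ¬ E₁ ⊆ convexHull ℝ E₂ ∧ ¬ E₂ ⊆ convexHull ℝ E₁ ∧
    S = convexHull ℝ (E₁ ∪ E₂)

/-- The 4-by-4 matrix `[α I, B* + I; B - I, -α I]` with the upper triangular block
`B = [b₁, b; 0, b₂]`, where `b` is real. -/
noncomputable def triangularizedMatrix (α b₁ b₂ : ℂ) (b : ℝ) : Matrix (Fin 4) (Fin 4) ℂ :=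
  !![α, 0, (starRingEnd ℂ) b₁ + 1, 0;
     0, α, (b : ℂ), (starRingEnd ℂ) b₂ + 1;
     b₁ - 1, (b : ℂ), -α, 0;
     0, b₂ - 1, 0, -α]

/-!
By Kippenhahn, the value in the direction `u` of the support function of the numerical range is the
greatest root of a polynomial in `m` whose coefficients are forms in `u`, here a biquadratic one.
For the convex hull of two ellipses the support function is the greater of two functions
`⟪u, cᵢ⟫ + √(Qᵢ u)` with `Qᵢ` a positive definite quadratic form, so it coincides on a nonempty open
set of directions with the one of an ellipse whose center is not the origin. As `Q` is irreducible
on a line missing the origin, `√Q` and `-√Q` are interchangeable in polynomial identities, and as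
the polynomial is even in `m`, it splits into the conics of two ellipses with centers `c` and `-c`.
Conversely such a splitting exhibits the numerical range as a bi-elliptical set. Comparing
coefficients turns the splitting into conditions on `b`, `b₁` and `b₂`.
-/

open scoped ComplexConjugate ComplexStarModule InnerProductSpace Polynomial

section ConvexHull

variable {E : Type*} [NormedAddCommGroup E] [NormedSpace ℝ E] [FiniteDimensional ℝ E]

theorem isCompact_convexHull {S : Set E} (hS : IsCompact S) : IsCompact (convexHull ℝ S) := by
  let combine (k : ℕ) (v : (Fin k → ℝ) × (Fin k → E)) : E := ∑ i, v.1 i • v.2 i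
  have caratheodory : convexHull ℝ S = ⋃ k ∈ Set.Iic (Module.finrank ℝ E + 1),
      combine k '' (stdSimplex ℝ (Fin k) ×ˢ Set.univ.pi fun _ => S) := by
    refine Set.Subset.antisymm (fun p hp => ?_) (Set.iUnion₂_subset fun k _ => ?_)
    · obtain ⟨ι, _, z, w, hz, hai, hw, hw1, rfl⟩ := eq_pos_convex_span_of_mem_convexHull hp
      have e := Fintype.equivFin ι
      have hcard : Fintype.card ι ≤ Module.finrank ℝ E + 1 :=
        hai.card_le_finrank_succ.trans (Nat.succ_le_succ (Submodule.finrank_le _))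
      refine Set.mem_biUnion hcard ⟨(w ∘ e.symm, z ∘ e.symm), ⟨⟨fun i => (hw _).le, ?_⟩, ?_⟩, ?_⟩
      · rw [← hw1]
        exact e.symm.sum_comp w
      · exact fun i _ => hz ⟨_, rfl⟩
      · exact e.symm.sum_comp fun i => w i • z i
    · rintro _ ⟨⟨w, z⟩, ⟨hw, hz⟩, rfl⟩
      exact (convex_convexHull ℝ S).sum_mem (fun i _ => hw.1 i) hw.2
        fun i _ => subset_convexHull ℝ S (hz i trivial)
  rw [caratheodory]
  refine (Set.finite_Iic _).isCompact_biUnion fun k _ => ?_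
  exact ((isCompact_stdSimplex ℝ _).prod (isCompact_univ_pi fun _ => hS)).image (by fun_prop)

end ConvexHull

section Support

variable {E : Type*} [NormedAddCommGroup E] [InnerProductSpace ℝ E] {S S' : Set E} {u : E}
  {m m' : ℝ}

/-- `m` is the value in the direction `u` of the support function of `S`, and it is attained. The
direction `u` need not be a unit vector. -/
def HasSupport (S : Set E) (u : E) (m : ℝ) : Prop :=
  IsGreatest ((fun w => ⟪u, w⟫_ℝ) '' S) m

namespace HasSupport

theorem inner_le (h : HasSupport S u m) {w : E} (hw : w ∈ S) : ⟪u, w⟫_ℝ ≤ m :=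
  h.2 (Set.mem_image_of_mem _ hw)

theorem convexHull (h : HasSupport S u m) : HasSupport (convexHull ℝ S) u m := by
  refine ⟨Set.image_mono (subset_convexHull ℝ S) h.1, ?_⟩
  rintro _ ⟨w, hw, rfl⟩
  exact convexHull_min (fun w hw => h.inner_le hw)
    (convex_halfSpace_le (innerₛₗ ℝ u).isLinear m) hw

theorem union (h : HasSupport S u m) (h' : HasSupport S' u m') :
    HasSupport (S ∪ S') u (max m m') := by
  rw [HasSupport, Set.image_union]
  exact IsGreatest.union h h'

theorem le_of_subset (h : HasSupport S u m) (h' : HasSupport S' u m') (hSS' : S ⊆ S') :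
    m ≤ m' :=
  h'.2 (Set.image_mono hSS' h.1)

end HasSupport

theorem subset_of_hasSupport_le [CompleteSpace E] (hconv : Convex ℝ S') (hclosed : IsClosed S')
    (h : ∀ u, ∃ m m', HasSupport S u m ∧ HasSupport S' u m' ∧ m ≤ m') : S ⊆ S' := by
  intro p hp
  by_contra hpS'
  obtain ⟨f, a, hS', hap⟩ := geometric_hahn_banach_closed_point hconv hclosed hpS'
  obtain ⟨u, rfl⟩ := (InnerProductSpace.toDual ℝ E).surjective f
  simp only [InnerProductSpace.toDual_apply_apply] at hS' hap
  obtain ⟨m, m', hm, hm', hle⟩ := h u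
  obtain ⟨w, hw, rfl⟩ := hm'.1
  exact (hap.trans_le (hm.inner_le hp)).not_ge (hle.trans (hS' w hw).le)

theorem eq_of_hasSupport [CompleteSpace E] (hS : Convex ℝ S) (hSc : IsClosed S)
    (hS' : Convex ℝ S') (hSc' : IsClosed S') {h : E → ℝ} (hs : ∀ u, HasSupport S u (h u))
    (hs' : ∀ u, HasSupport S' u (h u)) : S = S' :=
  Set.Subset.antisymm
    (subset_of_hasSupport_le hS' hSc' fun u => ⟨_, _, hs u, hs' u, le_rfl⟩)
    (subset_of_hasSupport_le hS hSc fun u => ⟨_, _, hs' u, hs u, le_rfl⟩)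

end Support

section ToeplitzHausdorff

variable {E : Type*} [NormedAddCommGroup E] [InnerProductSpace ℂ E]

theorem exists_norm_eq_one_im_mul_add_conj_mul_eq_zero (a d : ℂ) :
    ∃ μ : ℂ, ‖μ‖ = 1 ∧ (μ * a + conj μ * d).im = 0 := by
  obtain ⟨μ, hμ, h⟩ := RCLike.exists_norm_eq_mul_self (a - conj d)
  refine ⟨μ, hμ, ?_⟩
  have him : (μ * (a - conj d)).im = 0 := by rw [← h]; exact Complex.ofReal_im _
  simp only [Complex.add_im, Complex.mul_im, Complex.sub_re, Complex.sub_im, Complex.conj_re,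
    Complex.conj_im] at him ⊢
  linarith

theorem exists_inner_map_self_eq_mul_norm_sq (T : E →ₗ[ℂ] E) {x y : E} (hx0 : x ≠ 0)
    (hx : ⟪x, T x⟫_ℂ = 0) (hy : ⟪y, T y⟫_ℂ = 1) {s : ℝ} (hs : 0 ≤ s) (hsy : s * ‖y‖ ^ 2 ≤ 1) :
    ∃ z ≠ 0, ⟪z, T z⟫_ℂ = s * ‖z‖ ^ 2 := by
  obtain ⟨μ, hμ, him⟩ := exists_norm_eq_one_im_mul_add_conj_mul_eq_zero ⟪x, T y⟫_ℂ ⟪y, T x⟫_ℂ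
  set k : ℝ := (μ * ⟪x, T y⟫_ℂ + conj μ * ⟪y, T x⟫_ℂ).re
  have hkc : μ * ⟪x, T y⟫_ℂ + conj μ * ⟪y, T x⟫_ℂ = k := Complex.ext rfl him
  let z (t : ℝ) : E := (1 - t) • x + (t * μ) • y
  have form_z (t : ℝ) : ⟪z t, T (z t)⟫_ℂ = (t ^ 2 + t * (1 - t) * k : ℝ) := by
    have hμ2 : conj μ * μ = 1 := by rw [Complex.conj_mul', hμ]; norm_num
    have hz : z t = ((1 - t : ℝ) : ℂ) • x + (t * μ) • y := rfl
    simp only [hz, map_add, map_smul, inner_add_left, inner_add_right, inner_smul_left,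
      inner_smul_right, map_mul, Complex.conj_ofReal, hx, hy]
    push_cast
    linear_combination (t : ℂ) * (1 - t) * hkc + (t : ℂ) ^ 2 * hμ2
  have z_ne_zero (t : ℝ) : z t ≠ 0 := by
    intro hz
    have ht : t = 0 := by
      have hdep : ((1 - t : ℝ) : ℂ) • x = -((t * μ) • y) := eq_neg_of_add_eq_zero_left hz
      have h := congrArg (fun v => ⟪v, T v⟫_ℂ) hdep
      simpa [inner_smul_left, inner_smul_right, hx, hy, norm_ne_zero_iff.mp (hμ ▸ one_ne_zero)]
        using h
    exact hx0 (by simpa [z, ht] using hz)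
  have hcont : Continuous fun t : ℝ => t ^ 2 + t * (1 - t) * k - s * ‖z t‖ ^ 2 := by fun_prop
  obtain ⟨t, -, ht⟩ : (0 : ℝ) ∈ (fun t : ℝ => t ^ 2 + t * (1 - t) * k - s * ‖z t‖ ^ 2) ''
      Set.Icc 0 1 := by
    refine intermediate_value_Icc zero_le_one hcont.continuousOn ⟨?_, ?_⟩
    · simpa [z] using mul_nonneg hs (sq_nonneg ‖x‖)
    · simpa [z, norm_smul, hμ] using hsy
  refine ⟨z t, z_ne_zero t, ?_⟩
  rw [form_z, sub_eq_zero.mp ht]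
  push_cast
  rfl

/-- The **Toeplitz–Hausdorff theorem**. -/
theorem convex_setOf_inner_map_self (T : E →ₗ[ℂ] E) :
    Convex ℝ {w | ∃ x : E, ‖x‖ = 1 ∧ w = ⟪x, T x⟫_ℂ} := by
  rw [convex_iff_segment_subset]
  rintro _ ⟨x, hx, rfl⟩ _ ⟨y, hy, rfl⟩ w hw
  obtain ⟨s, ⟨hs0, hs1⟩, rfl⟩ := (segment_eq_image' ℝ ⟪x, T x⟫_ℂ ⟪y, T y⟫_ℂ) ▸ hw
  set w₁ := ⟪x, T x⟫_ℂ with hw₁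
  set w₂ := ⟪y, T y⟫_ℂ with hw₂
  by_cases hD : w₂ - w₁ = 0
  · exact ⟨x, hx, by simp [hD, ← hw₁]⟩
  let T' : E →ₗ[ℂ] E := (w₂ - w₁)⁻¹ • (T - w₁ • LinearMap.id)
  have hT' (z : E) : ⟪z, T' z⟫_ℂ = (w₂ - w₁)⁻¹ * (⟪z, T z⟫_ℂ - w₁ * ‖z‖ ^ 2) := by
    simp [T', inner_self_eq_norm_sq_to_K]
  obtain ⟨z, hz, hzs⟩ := exists_inner_map_self_eq_mul_norm_sq T' (x := x) (y := y)
    (norm_ne_zero_iff.mp (by simp [hx])) (by simp [hT', hx, hw₁])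
    (by simp [hT', hy, ← hw₂, hD]) hs0 (by simpa [hy] using hs1)
  rw [hT', inv_mul_eq_iff_eq_mul₀ hD] at hzs
  have hn : (‖z‖ : ℂ) ≠ 0 := by simpa using hz
  refine ⟨(‖z‖ : ℂ)⁻¹ • z, norm_smul_inv_norm hz, ?_⟩
  rw [map_smul, inner_smul_left, inner_smul_right, sub_eq_iff_eq_add.mp hzs]
  simp only [map_inv₀, Complex.conj_ofReal, Complex.real_smul]
  field_simp
  ring

end ToeplitzHausdorff

section NumericalRange

theorem isGreatest_hasEigenvalue_of_isGreatest_inner {𝕜 E : Type*} [RCLike 𝕜]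
    [NormedAddCommGroup E] [InnerProductSpace 𝕜 E] [FiniteDimensional 𝕜 E] {T : E →ₗ[𝕜] E}
    (hT : T.IsSymmetric) {m : ℝ}
    (hm : IsGreatest ((fun x => RCLike.re ⟪x, T x⟫_𝕜) '' Metric.sphere 0 1) m) :
    IsGreatest {μ : ℝ | Module.End.HasEigenvalue T μ} m := by
  have := FiniteDimensional.complete 𝕜 E
  have reApply_eq (x : E) : hT.toSelfAdjoint.1.reApplyInnerSelf x = RCLike.re ⟪x, T x⟫_𝕜 :=
    inner_re_symm _ _
  constructor
  · obtain ⟨x, hx, hxm⟩ := hm.1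
    have hx1 : ‖x‖ = 1 := mem_sphere_zero_iff_norm.mp hx
    have hmax : IsMaxOn hT.toSelfAdjoint.1.reApplyInnerSelf (Metric.sphere 0 ‖x‖) x := by
      intro y hy
      rw [hx1] at hy
      simp only [reApply_eq]
      exact (hm.2 ⟨y, hy, rfl⟩).trans_eq hxm.symm
    have heig := hT.toSelfAdjoint.2.hasEigenvector_of_isLocalExtrOn
      (norm_ne_zero_iff.mp (by simp [hx1])) (Or.inr hmax.localize)
    have hval : hT.toSelfAdjoint.1.rayleighQuotient x = m := by
      rw [ContinuousLinearMap.rayleighQuotient, reApply_eq, hx1, ← hxm]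
      simp
    rw [hval] at heig
    exact Module.End.hasEigenvalue_of_hasEigenvector heig
  · intro μ hμ
    obtain ⟨x, hx⟩ := hμ.exists_hasEigenvector
    refine hm.2 ⟨((‖x‖ : 𝕜)⁻¹) • x, by simpa using norm_smul_inv_norm hx.2, ?_⟩
    have hn : (‖x‖ : 𝕜) ≠ 0 := by simpa using hx.2
    have h : ⟪(‖x‖ : 𝕜)⁻¹ • x, T ((‖x‖ : 𝕜)⁻¹ • x)⟫_𝕜 = μ := by
      rw [map_smul, hx.apply_eq_smul, inner_smul_left, inner_smul_right, inner_smul_right,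
        inner_self_eq_norm_sq_to_K, map_inv₀, RCLike.conj_ofReal]
      field_simp
    simp only [h, RCLike.ofReal_re]

theorem isGreatest_inner_iff_isGreatest_hasEigenvalue {𝕜 E : Type*} [RCLike 𝕜]
    [NormedAddCommGroup E] [InnerProductSpace 𝕜 E] [FiniteDimensional 𝕜 E] {T : E →ₗ[𝕜] E}
    (hT : T.IsSymmetric) {m : ℝ} :
    IsGreatest ((fun x => RCLike.re ⟪x, T x⟫_𝕜) '' Metric.sphere 0 1) m ↔
      IsGreatest {μ : ℝ | Module.End.HasEigenvalue T μ} m := by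
  refine ⟨isGreatest_hasEigenvalue_of_isGreatest_inner hT, fun hm => ?_⟩
  have := FiniteDimensional.proper_rclike 𝕜 E
  obtain ⟨x, hx⟩ := hm.1.exists_hasEigenvector
  have hne : (Metric.sphere (0 : E) 1).Nonempty :=
    ⟨((‖x‖ : 𝕜)⁻¹) • x, by simpa using norm_smul_inv_norm hx.2⟩
  have hcont : Continuous fun x => RCLike.re ⟪x, T x⟫_𝕜 := RCLike.continuous_re.comp
    (continuous_id.inner (LinearMap.continuous_of_finiteDimensional T))
  obtain ⟨m', hm'⟩ := ((isCompact_sphere 0 1).image hcont).exists_isGreatest (hne.image _)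
  rwa [hm.unique (isGreatest_hasEigenvalue_of_isGreatest_inner hT hm')]

variable {n : Type*} [Fintype n] [DecidableEq n]

theorem convex_numericalRange (A : Matrix n n ℂ) : Convex ℝ (numericalRange A) :=
  convex_setOf_inner_map_self _

theorem numericalRange_eq_image_sphere (A : Matrix n n ℂ) :
    numericalRange A =
      (fun x : EuclideanSpace ℂ n => ⟪x, A.toEuclideanLin x⟫_ℂ) '' Metric.sphere 0 1 := by
  ext w
  simp [numericalRange, eq_comm]

theorem isCompact_numericalRange (A : Matrix n n ℂ) : IsCompact (numericalRange A) := by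
  rw [numericalRange_eq_image_sphere]
  exact (isCompact_sphere _ _).image
    (continuous_id.inner (LinearMap.continuous_of_finiteDimensional _))

theorem re_inner_realPart_toEuclideanLin (A : Matrix n n ℂ) (x : EuclideanSpace ℂ n) :
    RCLike.re ⟪x, (ℜ A : Matrix n n ℂ).toEuclideanLin x⟫_ℂ =
      RCLike.re ⟪x, A.toEuclideanLin x⟫_ℂ := by
  have hstar : RCLike.re ⟪x, (star A).toEuclideanLin x⟫_ℂ =
      RCLike.re ⟪x, A.toEuclideanLin x⟫_ℂ := by
    rw [Matrix.star_eq_conjTranspose, Matrix.toEuclideanLin_conjTranspose_eq_adjoint,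
      LinearMap.adjoint_inner_right, inner_re_symm]
  rw [realPart_apply_coe, ← Complex.coe_smul, map_smul, map_add, LinearMap.smul_apply,
    LinearMap.add_apply, inner_smul_right, inner_add_right]
  simp only [RCLike.re_to_complex] at hstar ⊢
  rw [Complex.re_ofReal_mul, Complex.add_re, hstar]
  ring

theorem real_inner_inner_toEuclideanLin (A : Matrix n n ℂ) (u : ℂ) (x : EuclideanSpace ℂ n) :
    ⟪u, ⟪x, A.toEuclideanLin x⟫_ℂ⟫_ℝ =
      RCLike.re ⟪x, (ℜ (conj u • A) : Matrix n n ℂ).toEuclideanLin x⟫_ℂ := by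
  rw [re_inner_realPart_toEuclideanLin, map_smul, LinearMap.smul_apply, inner_smul_right, mul_comm]
  rfl

/-- Kippenhahn's description of the numerical range. -/
theorem hasSupport_numericalRange_iff (A : Matrix n n ℂ) (u : ℂ) (m : ℝ) :
    HasSupport (numericalRange A) u m ↔
      IsGreatest {μ : ℝ | (ℜ (conj u • A) : Matrix n n ℂ).charpoly.IsRoot (μ : ℂ)} m := by
  have hsymm : (ℜ (conj u • A) : Matrix n n ℂ).toEuclideanLin.IsSymmetric :=
    Matrix.isSymmetric_toEuclideanLin_iff.mpr (ℜ (conj u • A)).2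
  simp only [HasSupport, numericalRange_eq_image_sphere, Set.image_image,
    real_inner_inner_toEuclideanLin, isGreatest_inner_iff_isGreatest_hasEigenvalue hsymm,
    Module.End.hasEigenvalue_iff_mem_spectrum, Matrix.spectrum_toLpLin,
    Matrix.mem_spectrum_iff_isRoot_charpoly, Complex.coe_algebraMap, RCLike.ofReal]

end NumericalRange

section Ellipse

theorem real_inner_eq_re_mul_re_add_im_mul_im (u w : ℂ) :
    ⟪u, w⟫_ℝ = u.re * w.re + u.im * w.im := by
  simp [Complex.inner, mul_comm]

/-- The binary quadratic form `α x² + 2 β x y + γ y²`, evaluated at `u = x + i y`. It is positive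
definite when `0 < γ` and `β ^ 2 < α * γ`. -/
def binaryForm (α β γ : ℝ) (u : ℂ) : ℝ :=
  α * u.re ^ 2 + 2 * β * u.re * u.im + γ * u.im ^ 2

variable {α β γ : ℝ}

theorem mul_binaryForm (α β γ : ℝ) (u : ℂ) :
    γ * binaryForm α β γ u = (γ * u.im + β * u.re) ^ 2 + (α * γ - β ^ 2) * u.re ^ 2 := by
  unfold binaryForm
  ring

theorem binaryForm_nonneg (hγ : 0 < γ) (hdet : β ^ 2 < α * γ) (u : ℂ) :
    0 ≤ binaryForm α β γ u := by
  have : 0 < α * γ - β ^ 2 := sub_pos.mpr hdet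
  refine nonneg_of_mul_nonneg_right ?_ hγ
  rw [mul_binaryForm]
  positivity

theorem binaryForm_pos (hγ : 0 < γ) (hdet : β ^ 2 < α * γ) {u : ℂ} (hu : u.re ≠ 0) :
    0 < binaryForm α β γ u := by
  have : 0 < α * γ - β ^ 2 := sub_pos.mpr hdet
  refine pos_of_mul_pos_right ?_ hγ.le
  rw [mul_binaryForm]
  positivity

@[fun_prop]
theorem continuous_binaryForm (α β γ : ℝ) : Continuous (binaryForm α β γ) := by
  unfold binaryForm
  fun_prop

/-- The ellipse with center `c` whose semi-axes `r` and `s` are rotated by the angle `φ`. -/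
noncomputable def ellipse (c : ℂ) (r s φ : ℝ) : Set ℂ :=
  Set.range fun t : ℝ => c + Complex.exp (φ * Complex.I) *
    ((r * Real.cos t : ℝ) + (s * Real.sin t : ℝ) * Complex.I)

theorem isCompact_ellipse (c : ℂ) (r s φ : ℝ) : IsCompact (ellipse c r s φ) := by
  have hp : Function.Periodic (fun t : ℝ => c + Complex.exp (φ * Complex.I) *
      ((r * Real.cos t : ℝ) + (s * Real.sin t : ℝ) * Complex.I)) (2 * Real.pi) := by
    intro t
    simp only [Real.cos_add_two_pi, Real.sin_add_two_pi]
  rw [ellipse, ← hp.image_Icc Real.two_pi_pos 0]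
  exact isCompact_Icc.image (by fun_prop)

theorem isGreatest_mul_cos_add_mul_sin (P Q : ℝ) :
    IsGreatest (Set.range fun t : ℝ => P * Real.cos t + Q * Real.sin t) √(P ^ 2 + Q ^ 2) := by
  constructor
  · have hn : √(P ^ 2 + Q ^ 2) = ‖(⟨P, Q⟩ : ℂ)‖ := by
      rw [Complex.norm_def, Complex.normSq_mk, sq, sq]
    have hP := Complex.norm_mul_cos_arg ⟨P, Q⟩
    have hQ := Complex.norm_mul_sin_arg ⟨P, Q⟩
    rw [← hn] at hP hQ
    refine ⟨Complex.arg ⟨P, Q⟩, ?_⟩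
    linear_combination (-Real.cos (Complex.arg ⟨P, Q⟩)) * hP
      - Real.sin (Complex.arg ⟨P, Q⟩) * hQ
      + √(P ^ 2 + Q ^ 2) * Real.cos_sq_add_sin_sq (Complex.arg ⟨P, Q⟩)
  · rintro _ ⟨t, rfl⟩
    apply Real.le_sqrt_of_sq_le
    nlinarith [sq_nonneg (P * Real.sin t - Q * Real.cos t), Real.cos_sq_add_sin_sq t]

theorem hasSupport_ellipse (c : ℂ) (r s φ : ℝ) (u : ℂ) :
    HasSupport (ellipse c r s φ) u (⟪u, c⟫_ℝ + √(binaryForm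
      (r ^ 2 * Real.cos φ ^ 2 + s ^ 2 * Real.sin φ ^ 2)
      ((r ^ 2 - s ^ 2) * Real.cos φ * Real.sin φ)
      (r ^ 2 * Real.sin φ ^ 2 + s ^ 2 * Real.cos φ ^ 2) u)) := by
  set P := r * (u.re * Real.cos φ + u.im * Real.sin φ) with hP
  set Q := s * (u.im * Real.cos φ - u.re * Real.sin φ) with hQ
  have inner_point (t : ℝ) : ⟪u, c + Complex.exp (φ * Complex.I) *
      ((r * Real.cos t : ℝ) + (s * Real.sin t : ℝ) * Complex.I)⟫_ℝ =
      ⟪u, c⟫_ℝ + (P * Real.cos t + Q * Real.sin t) := by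
    simp only [real_inner_eq_re_mul_re_add_im_mul_im, Complex.add_re, Complex.mul_re,
      Complex.exp_ofReal_mul_I_re, Complex.exp_ofReal_mul_I_im, Complex.ofReal_re,
      Complex.ofReal_im, Complex.I_re, Complex.I_im, Complex.add_im, Complex.mul_im, hP, hQ]
    ring
  have form_eq : binaryForm (r ^ 2 * Real.cos φ ^ 2 + s ^ 2 * Real.sin φ ^ 2)
      ((r ^ 2 - s ^ 2) * Real.cos φ * Real.sin φ)
      (r ^ 2 * Real.sin φ ^ 2 + s ^ 2 * Real.cos φ ^ 2) u = P ^ 2 + Q ^ 2 := by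
    simp only [binaryForm, hP, hQ]
    ring
  rw [HasSupport, ellipse, ← Set.range_comp, form_eq]
  obtain ⟨⟨t, ht⟩, hmax⟩ := isGreatest_mul_cos_add_mul_sin P Q
  refine ⟨⟨t, (inner_point t).trans (congrArg _ ht)⟩, ?_⟩
  rintro _ ⟨t', rfl⟩
  exact (inner_point t').trans_le (by gcongr; exact hmax ⟨t', rfl⟩)

namespace IsEllipseWithCenter

variable {E : Set ℂ} {c : ℂ}

protected theorem isCompact (h : IsEllipseWithCenter E c) : IsCompact E := by
  obtain ⟨r, s, φ, -, -, rfl⟩ := h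
  exact isCompact_ellipse c r s φ

theorem exists_hasSupport (h : IsEllipseWithCenter E c) :
    ∃ α β γ : ℝ, 0 < γ ∧ β ^ 2 < α * γ ∧
      ∀ u, HasSupport E u (⟪u, c⟫_ℝ + √(binaryForm α β γ u)) := by
  obtain ⟨r, s, φ, hr, hs, rfl⟩ := h
  refine ⟨_, _, _, ?_, ?_, hasSupport_ellipse c r s φ⟩
  · have hmin : 0 < min (r ^ 2) (s ^ 2) := by positivity
    calc 0 < min (r ^ 2) (s ^ 2) * (Real.sin φ ^ 2 + Real.cos φ ^ 2) := by simpa using hmin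
      _ ≤ r ^ 2 * Real.sin φ ^ 2 + s ^ 2 * Real.cos φ ^ 2 := by
        rw [mul_add]
        gcongr
        exacts [min_le_left _ _, min_le_right _ _]
  · have hdet : (r ^ 2 * Real.cos φ ^ 2 + s ^ 2 * Real.sin φ ^ 2) *
        (r ^ 2 * Real.sin φ ^ 2 + s ^ 2 * Real.cos φ ^ 2) -
        ((r ^ 2 - s ^ 2) * Real.cos φ * Real.sin φ) ^ 2 = (r * s) ^ 2 := by
      linear_combination (r * s) ^ 2 * (Real.cos φ ^ 2 + Real.sin φ ^ 2 + 1) *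
        Real.cos_sq_add_sin_sq φ
    rw [← sub_pos, hdet]
    positivity

end IsEllipseWithCenter

/-- `φ` is half the argument of `(α - γ) + 2 β i`, whose modulus is the difference of the
eigenvalues. -/
theorem exists_binaryForm_principal_axes (hγ : 0 < γ) (hdet : β ^ 2 < α * γ) :
    ∃ r s φ : ℝ, 0 < r ∧ 0 < s ∧ α = r ^ 2 * Real.cos φ ^ 2 + s ^ 2 * Real.sin φ ^ 2 ∧
      β = (r ^ 2 - s ^ 2) * Real.cos φ * Real.sin φ ∧
      γ = r ^ 2 * Real.sin φ ^ 2 + s ^ 2 * Real.cos φ ^ 2 := by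
  have hα : 0 < α := pos_of_mul_pos_left ((sq_nonneg β).trans_lt hdet) hγ.le
  set z : ℂ := ⟨α - γ, 2 * β⟩
  set φ := z.arg / 2 with hφ
  have hlt : ‖z‖ < α + γ := by
    refine lt_of_pow_lt_pow_left₀ 2 (by positivity) ?_
    rw [← Complex.normSq_eq_norm_sq, Complex.normSq_mk]
    linarith
  have hcos : ‖z‖ * (2 * Real.cos φ ^ 2 - 1) = α - γ := by
    rw [← Real.cos_two_mul, hφ, mul_div_cancel₀ _ two_ne_zero]
    exact Complex.norm_mul_cos_arg z
  have hsin : ‖z‖ * (2 * Real.sin φ * Real.cos φ) = 2 * β := by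
    rw [← Real.sin_two_mul, hφ, mul_div_cancel₀ _ two_ne_zero]
    exact Complex.norm_mul_sin_arg z
  have h1 := Real.cos_sq_add_sin_sq φ
  have hr : 0 < (α + γ + ‖z‖) / 2 := by positivity
  have hs : 0 < (α + γ - ‖z‖) / 2 := by linarith
  refine ⟨_, _, φ, Real.sqrt_pos.mpr hr, Real.sqrt_pos.mpr hs, ?_⟩
  rw [Real.sq_sqrt hr.le, Real.sq_sqrt hs.le]
  refine ⟨?_, ?_, ?_⟩
  · linear_combination (-1 / 2 : ℝ) * hcos - ((α + γ - ‖z‖) / 2) * h1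
  · linear_combination (-1 / 2 : ℝ) * hsin
  · linear_combination (1 / 2 : ℝ) * hcos - ((α + γ + ‖z‖) / 2) * h1

theorem exists_isEllipseWithCenter_hasSupport (c : ℂ) (hγ : 0 < γ) (hdet : β ^ 2 < α * γ) :
    ∃ E, IsEllipseWithCenter E c ∧
      ∀ u, HasSupport E u (⟪u, c⟫_ℝ + √(binaryForm α β γ u)) := by
  obtain ⟨r, s, φ, hr, hs, rfl, rfl, rfl⟩ := exists_binaryForm_principal_axes hγ hdet
  exact ⟨ellipse c r s φ, ⟨r, s, φ, hr, hs, rfl⟩, hasSupport_ellipse c r s φ⟩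

end Ellipse

section BiElliptical

variable {S E₁ E₂ : Set ℂ} {c c₁ c₂ : ℂ} {α β γ : ℝ}

theorem IsEllipseWithCenter.exists_isOpen_hasSupport_convexHull_union
    (h₁ : IsEllipseWithCenter E₁ c₁) (h₂ : IsEllipseWithCenter E₂ c₂)
    (hsub : ¬ E₁ ⊆ convexHull ℝ E₂) :
    ∃ α β γ : ℝ, 0 < γ ∧ β ^ 2 < α * γ ∧ ∃ U : Set ℂ, IsOpen U ∧ U.Nonempty ∧
      ∀ u ∈ U, HasSupport (convexHull ℝ (E₁ ∪ E₂)) u (⟪u, c₁⟫_ℝ + √(binaryForm α β γ u)) := by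
  obtain ⟨α, β, γ, hγ, hdet, hs₁⟩ := h₁.exists_hasSupport
  obtain ⟨α', β', γ', -, -, hs₂⟩ := h₂.exists_hasSupport
  refine ⟨α, β, γ, hγ, hdet, {u | ⟪u, c₂⟫_ℝ + √(binaryForm α' β' γ' u) <
    ⟪u, c₁⟫_ℝ + √(binaryForm α β γ u)}, isOpen_lt (by fun_prop) (by fun_prop), ?_, ?_⟩
  · by_contra! hempty
    refine hsub (subset_of_hasSupport_le (convex_convexHull ℝ E₂)
      (isCompact_convexHull h₂.isCompact).isClosed fun u => ?_)
    exact ⟨_, _, hs₁ u, (hs₂ u).convexHull, not_lt.mp fun hu => hempty.le hu⟩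
  · intro u hu
    have hunion := ((hs₁ u).union (hs₂ u)).convexHull
    rwa [max_eq_left (le_of_lt hu)] at hunion

theorem IsBiElliptical.exists_isOpen_hasSupport (hS : IsBiElliptical S) :
    ∃ c ≠ 0, ∃ α β γ : ℝ, 0 < γ ∧ β ^ 2 < α * γ ∧ ∃ U : Set ℂ, IsOpen U ∧ U.Nonempty ∧
      ∀ u ∈ U, HasSupport S u (⟪u, c⟫_ℝ + √(binaryForm α β γ u)) := by
  obtain ⟨E₁, E₂, c₁, c₂, h₁, h₂, hne, hsub₁, hsub₂, rfl⟩ := hS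
  by_cases hc₁ : c₁ = 0
  · refine ⟨c₂, fun hc₂ => hne (hc₁.trans hc₂.symm), ?_⟩
    rw [Set.union_comm]
    exact h₂.exists_isOpen_hasSupport_convexHull_union h₁ hsub₂
  · exact ⟨c₁, hc₁, h₁.exists_isOpen_hasSupport_convexHull_union h₂ hsub₁⟩

theorem not_subset_convexHull_of_hasSupport_lt {u : ℂ} {m m' : ℝ} (h₁ : HasSupport E₁ u m)
    (h₂ : HasSupport E₂ u m') (hlt : m' < m) : ¬ E₁ ⊆ convexHull ℝ E₂ := fun hsub =>
  (h₁.le_of_subset h₂.convexHull hsub).not_gt hlt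

theorem isBiElliptical_of_hasSupport (hS : Convex ℝ S) (hclosed : IsClosed S) (hc : c ≠ 0)
    (hγ : 0 < γ) (hdet : β ^ 2 < α * γ)
    (hsupp : ∀ u, HasSupport S u (|⟪u, c⟫_ℝ| + √(binaryForm α β γ u))) : IsBiElliptical S := by
  obtain ⟨E₁, hE₁, hs₁⟩ := exists_isEllipseWithCenter_hasSupport c hγ hdet
  obtain ⟨E₂, hE₂, hs₂⟩ := exists_isEllipseWithCenter_hasSupport (-c) hγ hdet
  have hcc : 0 < ⟪c, c⟫_ℝ := real_inner_self_pos.mpr hc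
  refine ⟨E₁, E₂, c, -c, hE₁, hE₂, self_ne_neg.mpr hc,
    not_subset_convexHull_of_hasSupport_lt (hs₁ c) (hs₂ c) ?_,
    not_subset_convexHull_of_hasSupport_lt (hs₂ (-c)) (hs₁ (-c)) ?_,
    eq_of_hasSupport hS hclosed (convex_convexHull ℝ _)
      (isCompact_convexHull (hE₁.isCompact.union hE₂.isCompact)).isClosed hsupp fun u => ?_⟩
  · rw [inner_neg_right]
    linarith
  · rw [inner_neg_neg, inner_neg_left]
    linarith
  · have hunion := ((hs₁ u).union (hs₂ u)).convexHull
    rwa [inner_neg_right, max_add_add_right, ← abs_eq_max_neg] at hunion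

end BiElliptical

section Kippenhahn

/-- The Kippenhahn polynomial of `triangularizedMatrix 0 b₁ b₂ b`: the characteristic polynomial,
at `m`, of its Hermitian part in the direction `u`. With `u = x + i y`, the two binary forms in it
are `|x b₁ + i y|²` and `|x b₂ + i y|²`. -/
noncomputable def kippenhahn (b₁ b₂ : ℂ) (b : ℝ) (u : ℂ) (m : ℝ) : ℝ :=
  m ^ 4
    - (binaryForm (‖b₁‖ ^ 2) b₁.im 1 u + binaryForm (‖b₂‖ ^ 2) b₂.im 1 u + (b * u.re) ^ 2) * m ^ 2
    + binaryForm (‖b₁‖ ^ 2) b₁.im 1 u * binaryForm (‖b₂‖ ^ 2) b₂.im 1 u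

theorem norm_sq_eq_re_sq_add_im_sq (z : ℂ) : ‖z‖ ^ 2 = z.re ^ 2 + z.im ^ 2 := by
  rw [← Complex.normSq_eq_norm_sq, Complex.normSq_apply, sq, sq]

theorem binaryForm_sq_norm_im_one (d u : ℂ) :
    binaryForm (‖d‖ ^ 2) d.im 1 u = ‖u.re * d + u.im * Complex.I‖ ^ 2 := by
  simp only [binaryForm, norm_sq_eq_re_sq_add_im_sq, Complex.add_re,
    Complex.add_im, Complex.mul_re, Complex.mul_im, Complex.ofReal_re, Complex.ofReal_im,
    Complex.I_re, Complex.I_im]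
  ring

theorem realPart_conj_smul_triangularizedMatrix (b₁ b₂ : ℂ) (b : ℝ) (u : ℂ) :
    (ℜ (conj u • triangularizedMatrix 0 b₁ b₂ b) : Matrix (Fin 4) (Fin 4) ℂ) =
      !![0, 0, conj (u.re * b₁ + u.im * Complex.I), 0;
         0, 0, (b * u.re : ℝ), conj (u.re * b₂ + u.im * Complex.I);
         u.re * b₁ + u.im * Complex.I, (b * u.re : ℝ), 0, 0;
         0, u.re * b₂ + u.im * Complex.I, 0, 0] := by
  rw [realPart_apply_coe]
  ext i j
  fin_cases i <;> fin_cases j <;> apply Complex.ext <;>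
    simp [triangularizedMatrix, Matrix.star_apply] <;> ring

theorem eval_charpoly_realPart_triangularizedMatrix (b₁ b₂ : ℂ) (b : ℝ) (u : ℂ) (m : ℝ) :
    (ℜ (conj u • triangularizedMatrix 0 b₁ b₂ b) : Matrix (Fin 4) (Fin 4) ℂ).charpoly.eval
      (m : ℂ) = kippenhahn b₁ b₂ b u m := by
  rw [Matrix.eval_charpoly, realPart_conj_smul_triangularizedMatrix, kippenhahn]
  simp only [binaryForm_sq_norm_im_one]
  push_cast
  simp only [← Complex.conj_mul']
  generalize (u.re * b₁ + u.im * Complex.I : ℂ) = c₁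
  generalize (u.re * b₂ + u.im * Complex.I : ℂ) = c₂
  simp [Matrix.det_succ_row_zero, Fin.sum_univ_succ, Fin.succAbove]
  ring

theorem hasSupport_numericalRange_iff_kippenhahn (b₁ b₂ : ℂ) (b : ℝ) (u : ℂ) (m : ℝ) :
    HasSupport (numericalRange (triangularizedMatrix 0 b₁ b₂ b)) u m ↔
      IsGreatest {μ | kippenhahn b₁ b₂ b u μ = 0} m := by
  simp only [hasSupport_numericalRange_iff, Polynomial.IsRoot,
    eval_charpoly_realPart_triangularizedMatrix, Complex.ofReal_eq_zero]

end Kippenhahn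

section SplittingPolynomial

open Polynomial

theorem eq_zero_of_sq_eq_sq_mul_prime {M : Type*} [CommMonoidWithZero M] [IsCancelMulZero M]
    [WfDvdMonoid M] {a b q : M} (hq : Prime q) (h : a ^ 2 = b ^ 2 * q) : b = 0 := by
  by_contra hb
  have hbq : b ^ 2 * q ≠ 0 := mul_ne_zero (pow_ne_zero 2 hb) hq.ne_zero
  have ha : a ≠ 0 := by
    rintro rfl
    exact hbq (by simpa using h.symm)
  have hparity := congrArg (multiplicity q) h
  rw [multiplicity_mul hq (.of_prime_left hq hbq),
    (FiniteMultiplicity.of_prime_left hq ha).multiplicity_pow hq,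
    (FiniteMultiplicity.of_prime_left hq hb).multiplicity_pow hq, multiplicity_self] at hparity
  lia

theorem eq_zero_of_infinite_add_mul_sqrt_eq_zero {a b q : ℝ[X]} (hq : Irreducible q) {S : Set ℝ}
    (hS : S.Infinite) (hnonneg : ∀ t ∈ S, 0 ≤ q.eval t)
    (h : ∀ t ∈ S, a.eval t + b.eval t * √(q.eval t) = 0) : a = 0 ∧ b = 0 := by
  have hsq : a ^ 2 = b ^ 2 * q := by
    refine eq_of_infinite_eval_eq _ _ (hS.mono fun t ht => ?_)
    simp only [Set.mem_ofPred_eq, eval_pow, eval_mul]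
    linear_combination (a.eval t - b.eval t * √(q.eval t)) * h t ht
      + b.eval t ^ 2 * Real.sq_sqrt (hnonneg t ht)
  have hb : b = 0 := eq_zero_of_sq_eq_sq_mul_prime hq.prime hsq
  exact ⟨by simpa [hb] using hsq, hb⟩

theorem eq_of_infinite_biquadratic_root {l q T F : ℝ[X]} (hl : l ≠ 0) (hq : Irreducible q)
    {S : Set ℝ} (hS : S.Infinite) (hnonneg : ∀ t ∈ S, 0 ≤ q.eval t)
    (h : ∀ t ∈ S, (l.eval t + √(q.eval t)) ^ 4 - T.eval t * (l.eval t + √(q.eval t)) ^ 2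
      + F.eval t = 0) : T = 2 * (l ^ 2 + q) ∧ F = (l ^ 2 - q) ^ 2 := by
  obtain ⟨ha, hb⟩ := eq_zero_of_infinite_add_mul_sqrt_eq_zero
    (a := (l ^ 2 + q) ^ 2 + 4 * l ^ 2 * q - T * (l ^ 2 + q) + F)
    (b := 2 * l * (2 * (l ^ 2 + q) - T)) hq hS hnonneg fun t ht => by
      simp only [eval_add, eval_sub, eval_mul, eval_pow, eval_ofNat]
      linear_combination h t ht - (6 * l.eval t ^ 2 + 4 * l.eval t * √(q.eval t)
        + √(q.eval t) ^ 2 + q.eval t - T.eval t) * Real.sq_sqrt (hnonneg t ht)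
  have hT : T = 2 * (l ^ 2 + q) :=
    (sub_eq_zero.mp ((mul_eq_zero.mp hb).resolve_left (mul_ne_zero two_ne_zero hl))).symm
  exact ⟨hT, by linear_combination ha + (l ^ 2 + q) * hT⟩

/-- The restriction of `binaryForm α β γ` to the vertical line of real part `x`, as a polynomial
in the imaginary part. -/
noncomputable def binaryFormPoly (α β γ x : ℝ) : ℝ[X] :=
  C γ * X ^ 2 + C (2 * β * x) * X + C (α * x ^ 2)

theorem eval_binaryFormPoly (α β γ x y : ℝ) :
    (binaryFormPoly α β γ x).eval y = binaryForm α β γ ⟨x, y⟩ := by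
  simp only [binaryFormPoly, binaryForm, eval_add, eval_mul, eval_pow, eval_C, eval_X]
  ring

theorem irreducible_binaryFormPoly {α β γ x : ℝ} (hγ : 0 < γ) (hdet : β ^ 2 < α * γ)
    (hx : x ≠ 0) : Irreducible (binaryFormPoly α β γ x) := by
  have hdeg : (binaryFormPoly α β γ x).natDegree = 2 := natDegree_quadratic hγ.ne'
  rw [irreducible_iff_roots_eq_zero_of_degree_le_three hdeg.ge (by lia),
    Multiset.eq_zero_iff_forall_notMem]
  intro y hy
  have hroot := isRoot_of_mem_roots hy
  rw [IsRoot, eval_binaryFormPoly] at hroot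
  exact (binaryForm_pos hγ hdet (u := ⟨x, y⟩) hx).ne' hroot

end SplittingPolynomial

section Splitting

open Polynomial

/-- The splitting of the Kippenhahn polynomial into the two conics with centers `c` and `-c` whose
support functions are `u ↦ ± ⟪u, c⟫ + √(binaryForm α β γ u)`. -/
def KippenhahnSplits (b₁ b₂ : ℂ) (b : ℝ) (c : ℂ) (α β γ : ℝ) : Prop :=
  ∀ u m, kippenhahn b₁ b₂ b u m =
    ((m - ⟪u, c⟫_ℝ) ^ 2 - binaryForm α β γ u) * ((m + ⟪u, c⟫_ℝ) ^ 2 - binaryForm α β γ u)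

variable {b₁ b₂ c : ℂ} {b α β γ : ℝ}

theorem isGreatest_kippenhahn_of_splits (h : KippenhahnSplits b₁ b₂ b c α β γ) {u : ℂ}
    (hq : 0 ≤ binaryForm α β γ u) :
    IsGreatest {m | kippenhahn b₁ b₂ b u m = 0} (|⟪u, c⟫_ℝ| + √(binaryForm α β γ u)) := by
  have hroots (m : ℝ) : kippenhahn b₁ b₂ b u m = 0 ↔
      |m - ⟪u, c⟫_ℝ| = √(binaryForm α β γ u) ∨ |m + ⟪u, c⟫_ℝ| = √(binaryForm α β γ u) := by
    simp only [h u m, mul_eq_zero, sub_eq_zero, ← Real.sqrt_sq_eq_abs,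
      Real.sqrt_inj (sq_nonneg _) hq]
  constructor
  · rw [Set.mem_ofPred_eq, hroots]
    obtain hl | hl := abs_choice ⟪u, c⟫_ℝ
    · left
      rw [hl, add_sub_cancel_left, abs_of_nonneg (Real.sqrt_nonneg _)]
    · right
      rw [hl, neg_add_cancel_comm, abs_of_nonneg (Real.sqrt_nonneg _)]
  · intro m hm
    obtain hm | hm := (hroots m).mp hm <;>
      linarith [le_abs_self (m - ⟪u, c⟫_ℝ), le_abs_self (m + ⟪u, c⟫_ℝ), le_abs_self ⟪u, c⟫_ℝ,
        neg_abs_le ⟪u, c⟫_ℝ]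

theorem isBiElliptical_of_kippenhahnSplits (hc : c ≠ 0) (hγ : 0 < γ) (hdet : β ^ 2 < α * γ)
    (h : KippenhahnSplits b₁ b₂ b c α β γ) :
    IsBiElliptical (numericalRange (triangularizedMatrix 0 b₁ b₂ b)) :=
  isBiElliptical_of_hasSupport (convex_numericalRange _) (isCompact_numericalRange _).isClosed hc
    hγ hdet fun u => (hasSupport_numericalRange_iff_kippenhahn b₁ b₂ b u _).mpr
      (isGreatest_kippenhahn_of_splits h (binaryForm_nonneg hγ hdet u))

theorem forall_kippenhahn_eq_mul_iff (b₁ b₂ : ℂ) (b : ℝ) (u : ℂ) (l q : ℝ) :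
    (∀ m, kippenhahn b₁ b₂ b u m = ((m - l) ^ 2 - q) * ((m + l) ^ 2 - q)) ↔
      binaryForm (‖b₁‖ ^ 2) b₁.im 1 u + binaryForm (‖b₂‖ ^ 2) b₂.im 1 u + (b * u.re) ^ 2 =
        2 * (l ^ 2 + q) ∧
      binaryForm (‖b₁‖ ^ 2) b₁.im 1 u * binaryForm (‖b₂‖ ^ 2) b₂.im 1 u = (l ^ 2 - q) ^ 2 := by
  unfold kippenhahn
  refine ⟨fun h => ⟨by linear_combination h 0 - h 1, by linear_combination h 0⟩, ?_⟩
  rintro ⟨hT, hF⟩ m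
  linear_combination -m ^ 2 * hT + hF

theorem binaryForm_smul (α β γ t : ℝ) (u : ℂ) :
    binaryForm α β γ (t • u) = t ^ 2 * binaryForm α β γ u := by
  simp only [binaryForm, Complex.smul_re, Complex.smul_im, smul_eq_mul]
  ring

theorem kippenhahn_smul (b₁ b₂ : ℂ) (b t : ℝ) (u : ℂ) (m : ℝ) :
    kippenhahn b₁ b₂ b (t • u) (t * m) = t ^ 4 * kippenhahn b₁ b₂ b u m := by
  simp only [kippenhahn, binaryForm_smul, Complex.smul_re, smul_eq_mul]
  ring

theorem kippenhahn_eq_mul_of_infinite (hc : c ≠ 0) (hγ : 0 < γ) (hdet : β ^ 2 < α * γ) {x : ℝ}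
    (hx : x ≠ 0) {Y : Set ℝ} (hY : Y.Infinite)
    (h : ∀ y ∈ Y, kippenhahn b₁ b₂ b ⟨x, y⟩ (⟪⟨x, y⟩, c⟫_ℝ + √(binaryForm α β γ ⟨x, y⟩)) = 0)
    (y m : ℝ) :
    kippenhahn b₁ b₂ b ⟨x, y⟩ m = ((m - ⟪⟨x, y⟩, c⟫_ℝ) ^ 2 - binaryForm α β γ ⟨x, y⟩) *
      ((m + ⟪⟨x, y⟩, c⟫_ℝ) ^ 2 - binaryForm α β γ ⟨x, y⟩) := by
  set l : ℝ[X] := C (x * c.re) + X * C c.im with hl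
  have eval_l (y : ℝ) : l.eval y = ⟪⟨x, y⟩, c⟫_ℝ := by
    simp only [hl, real_inner_eq_re_mul_re_add_im_mul_im, eval_add, eval_mul, eval_C, eval_X]
  have l_ne_zero : l ≠ 0 := by
    intro h0
    have hre : c.re = 0 := by simpa [hl, hx] using congrArg (eval 0) h0
    have him : c.im = 0 := by simpa [hl, hre] using congrArg (eval 1) h0
    exact hc (Complex.ext hre him)
  obtain ⟨hT, hF⟩ := eq_of_infinite_biquadratic_root
    (T := binaryFormPoly (‖b₁‖ ^ 2) b₁.im 1 x + binaryFormPoly (‖b₂‖ ^ 2) b₂.im 1 x +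
      C ((b * x) ^ 2))
    (F := binaryFormPoly (‖b₁‖ ^ 2) b₁.im 1 x * binaryFormPoly (‖b₂‖ ^ 2) b₂.im 1 x)
    l_ne_zero (irreducible_binaryFormPoly hγ hdet hx) hY
    (fun y _ => by simpa only [eval_binaryFormPoly] using binaryForm_nonneg hγ hdet _)
    (fun y hy => by
      simpa only [eval_l, eval_binaryFormPoly, eval_add, eval_mul, eval_C, kippenhahn]
        using h y hy)
  refine (forall_kippenhahn_eq_mul_iff b₁ b₂ b ⟨x, y⟩ _ _).mpr ⟨?_, ?_⟩ m
  · simpa only [eval_l, eval_binaryFormPoly, eval_add, eval_mul, eval_pow, eval_C, eval_ofNat]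
      using congrArg (eval y) hT
  · simpa only [eval_l, eval_binaryFormPoly, eval_sub, eval_mul, eval_pow]
      using congrArg (eval y) hF

theorem exists_ne_zero_infinite_setOf_mk_mem {U : Set ℂ} (hU : IsOpen U) (hne : U.Nonempty) :
    ∃ x ≠ 0, {y : ℝ | (⟨x, y⟩ : ℂ) ∈ U}.Infinite := by
  obtain ⟨u, huU, hu⟩ := (dense_compl_singleton (0 : ℝ)).preimage Complex.isOpenMap_re
    |>.inter_open_nonempty U hU hne
  have hcont : Continuous fun y : ℝ => (⟨u.re, y⟩ : ℂ) :=
    Complex.equivRealProdCLM.symm.continuous.comp (Continuous.prodMk_right u.re)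
  exact ⟨u.re, hu, infinite_of_mem_nhds u.im ((hU.preimage hcont).mem_nhds huU)⟩

/-- The identity is first obtained on one vertical line that meets `U`, then by homogeneity off the
imaginary axis, and finally everywhere by continuity. -/
theorem kippenhahnSplits_of_isOpen (hc : c ≠ 0) (hγ : 0 < γ) (hdet : β ^ 2 < α * γ) {U : Set ℂ}
    (hU : IsOpen U) (hne : U.Nonempty)
    (h : ∀ u ∈ U, kippenhahn b₁ b₂ b u (⟪u, c⟫_ℝ + √(binaryForm α β γ u)) = 0) :
    KippenhahnSplits b₁ b₂ b c α β γ := by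
  obtain ⟨x, hx, hY⟩ := exists_ne_zero_infinite_setOf_mk_mem hU hne
  have on_line := kippenhahn_eq_mul_of_infinite hc hγ hdet hx hY fun y hy => h _ hy
  have off_axis (u : ℂ) (hu : u.re ≠ 0) (m : ℝ) : kippenhahn b₁ b₂ b u m =
      ((m - ⟪u, c⟫_ℝ) ^ 2 - binaryForm α β γ u) * ((m + ⟪u, c⟫_ℝ) ^ 2 - binaryForm α β γ u) := by
    obtain ⟨t, ht, y, rfl⟩ : ∃ t : ℝ, t ≠ 0 ∧ ∃ y : ℝ, u = t • (⟨x, y⟩ : ℂ) := by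
      refine ⟨u.re / x, div_ne_zero hu hx, u.im * x / u.re, Complex.ext ?_ ?_⟩ <;>
        simp only [Complex.smul_re, Complex.smul_im, smul_eq_mul] <;> field_simp
    obtain ⟨m, rfl⟩ : ∃ m', m = t * m' := ⟨m / t, (mul_div_cancel₀ m ht).symm⟩
    rw [kippenhahn_smul, on_line, binaryForm_smul, real_inner_smul_left]
    ring
  intro u m
  have hdense : Dense {u : ℂ | u.re ≠ 0} :=
    (dense_compl_singleton (0 : ℝ)).preimage Complex.isOpenMap_re
  refine congrFun (Continuous.ext_on hdense ?_ (by fun_prop) fun u hu => off_axis u hu m) u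
  unfold kippenhahn
  fun_prop

theorem isBiElliptical_iff_exists_kippenhahnSplits :
    IsBiElliptical (numericalRange (triangularizedMatrix 0 b₁ b₂ b)) ↔
      ∃ c ≠ 0, ∃ α β γ : ℝ, 0 < γ ∧ β ^ 2 < α * γ ∧ KippenhahnSplits b₁ b₂ b c α β γ := by
  constructor
  · intro h
    obtain ⟨c, hc, α, β, γ, hγ, hdet, U, hU, hne, hs⟩ := h.exists_isOpen_hasSupport
    refine ⟨c, hc, α, β, γ, hγ, hdet, kippenhahnSplits_of_isOpen hc hγ hdet hU hne fun u hu => ?_⟩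
    exact ((hasSupport_numericalRange_iff_kippenhahn b₁ b₂ b u _).mp (hs u hu)).1
  · rintro ⟨c, hc, α, β, γ, hγ, hdet, hsplit⟩
    exact isBiElliptical_of_kippenhahnSplits hc hγ hdet hsplit

end Splitting

section Conditions

variable {b₁ b₂ c : ℂ} {b α β γ : ℝ}

theorem im_eq_and_norm_eq_or_re_eq_zero_iff (b₁ b₂ : ℂ) :
    ((b₁.im = b₂.im ∧ ‖b₁‖ = ‖b₂‖) ∨ (b₁.re = 0 ∧ b₂.re = 0)) ↔
      b₁.re ^ 2 = b₂.re ^ 2 ∧ (b₁.im = b₂.im ∨ b₁.re = 0) := by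
  have hnorm (him : b₁.im = b₂.im) : ‖b₁‖ = ‖b₂‖ ↔ b₁.re ^ 2 = b₂.re ^ 2 := by
    rw [← sq_eq_sq₀ (norm_nonneg _) (norm_nonneg _), norm_sq_eq_re_sq_add_im_sq,
      norm_sq_eq_re_sq_add_im_sq, him, add_left_inj]
  constructor
  · rintro (⟨him, h⟩ | ⟨h₁, h₂⟩)
    · exact ⟨(hnorm him).mp h, .inl him⟩
    · exact ⟨by rw [h₁, h₂], .inr h₁⟩
  · rintro ⟨hre, him | h₁⟩
    · exact .inl ⟨him, (hnorm him).mpr hre⟩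
    · exact .inr ⟨h₁, by simpa [h₁, eq_comm] using hre⟩

theorem forall_sum_and_prod_binaryForm_iff {N₁ N₂ s₁ s₂ : ℝ} (hγ : 0 < γ) :
    (∀ u, binaryForm N₁ s₁ 1 u + binaryForm N₂ s₂ 1 u + (b * u.re) ^ 2 =
        2 * (⟪u, c⟫_ℝ ^ 2 + binaryForm α β γ u) ∧
      binaryForm N₁ s₁ 1 u * binaryForm N₂ s₂ 1 u = (⟪u, c⟫_ℝ ^ 2 - binaryForm α β γ u) ^ 2) ↔
      c.im = 0 ∧ γ = 1 ∧ 2 * β = s₁ + s₂ ∧ 2 * α = N₁ + N₂ + b ^ 2 - 2 * c.re ^ 2 ∧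
      4 * c.re ^ 2 = b ^ 2 + (s₁ - s₂) ^ 2 ∧
      N₁ * s₂ + N₂ * s₁ = (α - c.re ^ 2) * (s₁ + s₂) ∧ N₁ * N₂ = (α - c.re ^ 2) ^ 2 := by
  simp only [real_inner_eq_re_mul_re_add_im_mul_im, binaryForm]
  constructor
  · intro h
    obtain ⟨T₁, F₁⟩ := h ⟨1, 0⟩
    obtain ⟨T₂, F₂⟩ := h ⟨0, 1⟩
    obtain ⟨T₃, F₃⟩ := h ⟨1, 1⟩
    obtain ⟨T₄, F₄⟩ := h ⟨1, -1⟩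
    dsimp only at T₁ F₁ T₂ F₂ T₃ F₃ T₄ F₄
    have hγ1 : γ = 1 := by
      refine mul_left_cancel₀ hγ.ne' ?_
      linear_combination (-1 / 4 : ℝ) * F₂ + (c.im ^ 2 - 3 * γ + 1) / 8 * T₂
    subst hγ1
    have hc : c.im = 0 := by
      refine pow_eq_zero_iff two_ne_zero |>.mp ?_
      linear_combination (-1 / 2 : ℝ) * T₂
    simp only [hc] at T₁ F₁ T₃ F₃ T₄ F₄
    have hβ : 2 * β = s₁ + s₂ := by linear_combination (T₄ - T₃) / 4
    refine ⟨hc, rfl, hβ, by linear_combination -T₁, ?_, ?_, by linear_combination F₁⟩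
    · linear_combination (F₃ + F₄) / 2 - F₁ - T₁ + (2 * β + s₁ + s₂) * hβ
    · linear_combination (F₃ - F₄) / 4 + (1 - c.re ^ 2 + α) * hβ
  · rintro ⟨hc, rfl, hβ, hα, hb, h₁, h₀⟩ u
    rw [hc]
    constructor
    · linear_combination u.re ^ 2 * (-hα) - 2 * u.re * u.im * hβ
    · linear_combination u.re ^ 4 * h₀ + 2 * u.re ^ 3 * u.im * (h₁ - (α - c.re ^ 2) * hβ)
        + u.re ^ 2 * u.im ^ 2 * (hb - hα - (2 * β + s₁ + s₂) * hβ) - 2 * u.re * u.im ^ 3 * hβ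

theorem cubic_and_quartic_coeff_iff (r₁ s₁ r₂ s₂ : ℝ) :
    ((r₁ ^ 2 + s₁ ^ 2) * s₂ + (r₂ ^ 2 + s₂ ^ 2) * s₁ =
        ((r₁ ^ 2 + r₂ ^ 2) / 2 + s₁ * s₂) * (s₁ + s₂) ∧
      (r₁ ^ 2 + s₁ ^ 2) * (r₂ ^ 2 + s₂ ^ 2) = ((r₁ ^ 2 + r₂ ^ 2) / 2 + s₁ * s₂) ^ 2) ↔
      r₁ ^ 2 = r₂ ^ 2 ∧ (s₁ = s₂ ∨ r₁ = 0) := by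
  rw [← sub_eq_zero (a := s₁), ← mul_eq_zero]
  constructor
  · rintro ⟨h₁, h₀⟩
    have hcubic : (s₁ - s₂) * (r₁ ^ 2 - r₂ ^ 2) = 0 := by
      linear_combination (-2 : ℝ) * h₁
    have hquartic : (r₁ ^ 2 - r₂ ^ 2) ^ 2 = 4 * (s₁ - s₂) * (r₂ ^ 2 * s₁ - r₁ ^ 2 * s₂) := by
      linear_combination (-4 : ℝ) * h₀
    have hr : r₁ ^ 2 - r₂ ^ 2 = 0 := by
      obtain hs | hr := mul_eq_zero.mp hcubic
      · refine pow_eq_zero_iff two_ne_zero |>.mp ?_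
        rw [hquartic, hs, mul_zero, zero_mul]
      · exact hr
    refine ⟨sub_eq_zero.mp hr, pow_eq_zero_iff two_ne_zero |>.mp ?_⟩
    linear_combination ((s₁ - s₂) * s₁ + (r₁ ^ 2 - r₂ ^ 2) / 4) * hr - hquartic / 4
  · rintro ⟨hr, hrs⟩
    constructor
    · linear_combination (-(s₁ - s₂) / 2) * hr
    · linear_combination (s₁ - s₂) * r₁ * hrs - ((s₁ - s₂) * s₁ + (r₁ ^ 2 - r₂ ^ 2) / 4) * hr

theorem kippenhahnSplits_iff (hγ : 0 < γ) :
    KippenhahnSplits b₁ b₂ b c α β γ ↔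
      c.im = 0 ∧ γ = 1 ∧ 2 * β = b₁.im + b₂.im ∧
      2 * α = ‖b₁‖ ^ 2 + ‖b₂‖ ^ 2 + b ^ 2 - 2 * c.re ^ 2 ∧
      4 * c.re ^ 2 = b ^ 2 + (b₁.im - b₂.im) ^ 2 ∧
      b₁.re ^ 2 = b₂.re ^ 2 ∧ (b₁.im = b₂.im ∨ b₁.re = 0) := by
  simp only [KippenhahnSplits, forall_kippenhahn_eq_mul_iff, forall_sum_and_prod_binaryForm_iff hγ]
  refine and_congr_right fun _ => and_congr_right fun _ => and_congr_right fun _ =>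
    and_congr_right fun hα => and_congr_right fun hc => ?_
  rw [norm_sq_eq_re_sq_add_im_sq, norm_sq_eq_re_sq_add_im_sq] at hα ⊢
  have hcenter : α - c.re ^ 2 = (b₁.re ^ 2 + b₂.re ^ 2) / 2 + b₁.im * b₂.im := by
    linear_combination (hα - hc) / 2
  rw [hcenter, cubic_and_quartic_coeff_iff]

theorem exists_kippenhahnSplits_iff :
    (∃ c ≠ 0, ∃ α β γ : ℝ, 0 < γ ∧ β ^ 2 < α * γ ∧ KippenhahnSplits b₁ b₂ b c α β γ) ↔
      b ≠ 0 ∧ b₁.re ^ 2 = b₂.re ^ 2 ∧ (b₁.im = b₂.im ∨ b₁.re = 0) := by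
  constructor
  · rintro ⟨c, hc, α, β, γ, hγ, hdet, hsplit⟩
    obtain ⟨him, rfl, hβ, hα, hcre, hre, h⟩ := (kippenhahnSplits_iff hγ).mp hsplit
    refine ⟨?_, hre, h⟩
    rintro rfl
    obtain hs | hr := h
    · refine hc (Complex.ext (pow_eq_zero_iff two_ne_zero |>.mp ?_) him)
      rw [hs] at hcre
      linear_combination hcre / 4
    · have hr₂ : b₂.re ^ 2 = 0 := by rw [← hre, hr, zero_pow two_ne_zero]
      refine hdet.ne ?_
      rw [norm_sq_eq_re_sq_add_im_sq, norm_sq_eq_re_sq_add_im_sq, hr] at hα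
      linear_combination (β / 2 + (b₁.im + b₂.im) / 4) * hβ - hα / 2 + hcre / 4 - hr₂ / 2
  · rintro ⟨hb, hre, h⟩
    set m := √(b ^ 2 + (b₁.im - b₂.im) ^ 2) / 2 with hm
    have hm2 : 4 * m ^ 2 = b ^ 2 + (b₁.im - b₂.im) ^ 2 := by
      rw [hm, div_pow, Real.sq_sqrt (by positivity)]
      ring
    have hm0 : m ≠ 0 := by positivity
    refine ⟨m, by simpa using hm0, (‖b₁‖ ^ 2 + ‖b₂‖ ^ 2 + b ^ 2 - 2 * m ^ 2) / 2,
      (b₁.im + b₂.im) / 2, 1, one_pos, ?_, (kippenhahnSplits_iff one_pos).mpr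
      ⟨Complex.ofReal_im m, rfl, by ring, by rw [Complex.ofReal_re]; ring, hm2, hre, h⟩⟩
    rw [norm_sq_eq_re_sq_add_im_sq, norm_sq_eq_re_sq_add_im_sq, ← sub_pos]
    have hpos : 0 < b₁.re ^ 2 + b ^ 2 / 4 := by positivity
    calc 0 < b₁.re ^ 2 + b ^ 2 / 4 := hpos
      _ = _ := by linear_combination hre / 2 + hm2 / 4

end Conditions

theorem corollary4p2 (b₁ b₂ : ℂ) (b : ℝ) :
    IsBiElliptical (numericalRange (triangularizedMatrix 0 b₁ b₂ b)) ↔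
      b ≠ 0 ∧ ((b₁.im = b₂.im ∧ ‖b₁‖ = ‖b₂‖) ∨ (b₁.re = 0 ∧ b₂.re = 0)) := by
  rw [isBiElliptical_iff_exists_kippenhahnSplits, exists_kippenhahnSplits_iff,
    im_eq_and_norm_eq_or_re_eq_zero_iff]
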